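/- Let $d\ge 3$ be an integer, let $\Omega(d)=\{x\in\mathbb{C}^d : x^*x=1\}$ and $\mathbb{D}=\{z\in\mathbb{C} : |z|\le 1\}$. For $n\ge 2$ and $k,l\in\mathbb{N}=\{0,1,2,\dots\}$ put \[ m^n_{k,l}=\binom{n+k-1}{n-1}\binom{n+l-1}{n-1}-\binom{n+k-2}{n-1}\binom{n+l-2}{n-1}, \] \[ g^n_{k,l}(x)=\frac{m^n_{k,l}\,(n-2)!\,k!\,l!}{(n+k-2)!\,(n+l-2)!}\sum_{r=0}^{\min\{k,l\}}(-1)^r\frac{(n+k+l-r-2)!}{r!\,(k-r)!\,(l-r)!}\,x^{k-r}\bar x^{\,l-r}\qquad(x\in\mathbb{C}). \] For $0\le i\le k$ and $0\le j\le l$ let $Y^{i,j}_{k,l}(u,v,t)$ be the complex matrix with rows and columns indexed by $0\le a,b\le \min(k-i,l-j)+1$ and entries \[ \big(Y^{i,j}_{k,l}(u,v,t)\big)_{a,b}=(1-u\bar u)^{\frac{i+j}{2}}(1-v\bar v)^{\frac{i+j}{2}}(u\bar u)^a(v\bar v)^b\,g^{d-1}_{i,j}\!\left(\frac{t-\bar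 u v}{\sqrt{(1-u\bar u)(1-v\bar v)}}\right); \] when $|u|=1$ or $|v|=1$ (and then $t=\bar u v$ for all triples used below) this is read as $0$ if $i+j>0$ and as $(u\bar u)^a(v\bar v)^b$ if $i=j=0$, with $z^0=1$ for all $z$. Let $A\subset\mathbb{D}\setminus\{1\}$ satisfy $\{\bar c : c\in A\}=A$, and put \[ D=\Big\{(u,v,t)\in A^3 : \left(\begin{smallmatrix}1&u&v\\ \bar u&1&t\\ \bar v&\bar t&1\end{smallmatrix}\right)\succeq 0\Big\}, \] \[ D_0=\{(u,u,1) : u\in A\}\cup\{(u,1,\bar u) : u\in A\}\cup\{(1,u,u) : u\in A\}. \] Let $X\subset\Omega(d)$ be a finite set such that $a^*b\in A$ for all distinct $a,b\in X$. Then \[ |X|\le 1+\sup \sum_{u\in A}x(u,u,1), \] where the supremum (taken in $[-\infty,\infty]$; it is the maximum whenever the maximum exists) is over all real-valued functions $x$ on $D\cup D_0$ such that 1. $x(u,v,t)=x(v,u,\bar t)=x(\bar t,\bar v,\bar u)=x(\bar v,\bar t,u)=x(\bar u,t,v)=x(t,\bar u,\bar v)$ for $(u,v,t)\in D\cup D_0$,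 and $x(u,u,1)=x(\bar u,\bar u,1)$, $x(u,1,\bar u)=x(\bar u,1,u)$, $x(1,u,u)=x(1,\bar u,\bar u)$ for $u\in A$; 2. $x(u,v,t)\ge 0$ for $(u,v,t)\in D\cup D_0$; 3. $x(u,v,t)=0$ for all but finitely many $(u,v,t)\in D\cup D_0$; 4. $\left(\begin{smallmatrix}1&0\\0&0\end{smallmatrix}\right)+\sum_{u\in A}x(u,u,1)\left(\begin{smallmatrix}0&1\\1&1\end{smallmatrix}\right)+\sum_{(u,v,t)\in D}x(u,v,t)\left(\begin{smallmatrix}0&0\\0&1\end{smallmatrix}\right)\succeq 0$; 5. $g^d_{k,l}(1)+\sum_{u\in A}x(u,u,1)\,g^d_{k,l}(u)$ is real and nonnegative for all $k,l\in\mathbb{N}$; 6. $Y^{i,j}_{k,l}(1,1,1)+\sum_{(u,v,t)\in D\cup D_0}x(u,v,t)\,Y^{i,j}_{k,l}(u,v,t)$ is Hermitian positive semidefinite for all $k,l\in\mathbb{N}$, $0\le i\le k$, $0\le j\le l$. -/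

import Mathlib

open scoped Nat ComplexOrder ComplexConjugate

noncomputable section

/-- The unit sphere `Ω(d)` of `ℂ^d`. -/
def unitSphere (d : ℕ) : Set (EuclideanSpace ℂ (Fin d)) :=
  {x | inner ℂ x x = 1}

/-- The inner product set `A(X) = {a^* b | a, b ∈ X, a ≠ b}`; here `inner ℂ a b` is conjugate-linear
in `a`, so that it is `a^* b`. -/
def innerProductSet {d : ℕ} (X : Set (EuclideanSpace ℂ (Fin d))) : Set ℂ :=
  {c | ∃ a ∈ X, ∃ b ∈ X, a ≠ b ∧ inner ℂ a b = c}

/-- The dimension `m^d_{k,l}` of `Harm_d(k,l)`, for `d ≥ 2`, as an element of `ℂ`. -/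
def harmDim (d k l : ℕ) : ℂ :=
  ((d + k - 1).choose (d - 1) : ℂ) * ((d + l - 1).choose (d - 1) : ℂ)
    - ((d + k - 2).choose (d - 1) : ℂ) * ((d + l - 2).choose (d - 1) : ℂ)

/-- The Jacobi polynomial `g^d_{k,l}`, for `d ≥ 2` (no subtraction of natural numbers truncates
then). -/
def jacobiG (d k l : ℕ) (x : ℂ) : ℂ :=
  harmDim d k l * ((d - 2)! : ℂ) * (k ! : ℂ) * (l ! : ℂ)
      / (((d + k - 2)! : ℂ) * ((d + l - 2)! : ℂ))
    * ∑ r ∈ Finset.range (min k l + 1),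
        (-1 : ℂ) ^ r
          * (((d + k + l - r - 2)! : ℂ) / ((r ! : ℂ) * ((k - r)! : ℂ) * ((l - r)! : ℂ)))
          * x ^ (k - r) * (conj x) ^ (l - r)

/-- The multiplicity `m^{i,j}_{k,l} = min(k - i, l - j) + 1` of `Harm_{d-1}(i,j)` in `Hom_d(k,l)`,
for `i ≤ k` and `j ≤ l`. -/
def zonalMult (k l i j : ℕ) : ℕ := min (k - i) (l - j) + 1

/-- The zonal matrix `Y^{i,j}_{k,l}(u,v,t)` of `U(d-1)`, with rows and columns indexed by
`0 ≤ a, b ≤ m^{i,j}_{k,l}`: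
`(1 - uū)^{(i+j)/2} (1 - v v̄)^{(i+j)/2} (uū)^a (v v̄)^b
  g^{d-1}_{i,j}((t - ū v) / √((1 - uū)(1 - v v̄)))`.
The function is used where `|u|, |v| ≤ 1` and the Hermitian matrix `gramMatrix u v t` is positive
semidefinite. If `|u| = 1` or `|v| = 1` there, then `t = ū v`, and the value, which is `0` for
`i + j > 0` and `(uū)^a (v v̄)^b` for `i = j = 0`, is the value of the polynomial in
`u, v, t` and their conjugates to which the formula simplifies. -/
def zonalY (d k l i j : ℕ) (u v t : ℂ) :
    Matrix (Fin (zonalMult k l i j + 1)) (Fin (zonalMult k l i j + 1)) ℂ :=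
  Matrix.of fun a b =>
    ((Real.sqrt (1 - Complex.normSq u) : ℝ) : ℂ) ^ (i + j)
      * ((Real.sqrt (1 - Complex.normSq v) : ℝ) : ℂ) ^ (i + j)
      * (u * conj u) ^ (a : ℕ) * (v * conj v) ^ (b : ℕ)
      * jacobiG (d - 1) i j
          ((t - conj u * v)
            / ((Real.sqrt ((1 - Complex.normSq u) * (1 - Complex.normSq v)) : ℝ) : ℂ))

/-- The Gram matrix of three unit vectors `x, y, z` with `x^* y = u`, `x^* z = v`, `y^* z = t`. -/
def gramMatrix (u v t : ℂ) : Matrix (Fin 3) (Fin 3) ℂ :=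
  !![1, u, v; conj u, 1, t; conj v, conj t, 1]

/-- The set `D` of admissible triples of elements of `A`. -/
def tripleSet (A : Set ℂ) : Set (ℂ × ℂ × ℂ) :=
  {p | p.1 ∈ A ∧ p.2.1 ∈ A ∧ p.2.2 ∈ A ∧ (gramMatrix p.1 p.2.1 p.2.2).PosSemidef}

/-- The set `D₀` of degenerate triples, in which exactly two of the three points coincide. -/
def degenerateSet (A : Set ℂ) : Set (ℂ × ℂ × ℂ) :=
  {p | ∃ u ∈ A, p = (u, u, 1)} ∪ {p | ∃ u ∈ A, p = (u, 1, conj u)} ∪ {p | ∃ u ∈ A, p = (1, u, u)}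

/-- The constraints of the semidefinite program, in the variables `x(u,v,t)`,
`(u,v,t) ∈ D ∪ D₀` (the values of `x` elsewhere play no role). -/
structure SDPFeasible (d : ℕ) (A : Set ℂ) (x : ℂ × ℂ × ℂ → ℝ) : Prop where
  /-- invariance under the permutations of the three points -/
  symm : ∀ u v t : ℂ, (u, v, t) ∈ tripleSet A ∪ degenerateSet A →
    x (u, v, t) = x (v, u, conj t) ∧
    x (u, v, t) = x (conj t, conj v, conj u) ∧
    x (u, v, t) = x (conj v, conj t, u) ∧
    x (u, v, t) = x (conj u, t, v) ∧
    x (u, v, t) = x (t, conj u, conj v)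
  /-- invariance of the degenerate variables under exchange of the two points -/
  symm_degenerate : ∀ u ∈ A,
    x (u, u, 1) = x (conj u, conj u, 1) ∧
    x (u, 1, conj u) = x (conj u, 1, u) ∧
    x (1, u, u) = x (1, conj u, conj u)
  nonneg : ∀ p ∈ tripleSet A ∪ degenerateSet A, 0 ≤ x p
  finite : {p | p ∈ tripleSet A ∪ degenerateSet A ∧ x p ≠ 0}.Finite
  counting :
    ((!![1, 0; 0, 0] : Matrix (Fin 2) (Fin 2) ℝ)
      + (∑ᶠ u ∈ A, x (u, u, 1)) • (!![0, 1; 1, 1] : Matrix (Fin 2) (Fin 2) ℝ)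
      + (∑ᶠ p ∈ tripleSet A, x p) • (!![0, 0; 0, 1] : Matrix (Fin 2) (Fin 2) ℝ)).PosSemidef
  /-- the sum is a nonnegative real number -/
  linear : ∀ k l : ℕ,
    0 ≤ jacobiG d k l 1 + ∑ᶠ u ∈ A, (x (u, u, 1) : ℂ) * jacobiG d k l u
  zonal : ∀ k l i j : ℕ, i ≤ k → j ≤ l →
    (zonalY d k l i j 1 1 1
      + ∑ᶠ p ∈ tripleSet A ∪ degenerateSet A,
          (x p : ℂ) • zonalY d k l i j p.1 p.2.1 p.2.2).PosSemidef

/-- The optimum of the semidefinite program: the supremum, in the extended reals, of the objective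
`∑_{u ∈ A} x(u,u,1)` over the feasible points (so the maximum, whenever that exists). -/
def sdpOptimum (d : ℕ) (A : Set ℂ) : EReal :=
  ⨆ (x : ℂ × ℂ × ℂ → ℝ) (_ : SDPFeasible d A x), ((∑ᶠ u ∈ A, x (u, u, 1) : ℝ) : EReal)

end

/-! For nonempty `X` of size N, let x(u,v,t) be 1/N times the number of triples (a,b,c) in X³ with
inner products (u,v,t). This point is feasible and has objective N - 1, so the supremum is at least
N - 1. Permuting triples gives the symmetries, and the counting matrix is the rank-one square of (1,
N - 1).

The constraints 5 and 6 rest on positive definiteness of the Jacobi kernels. In the Fischer form,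
multiplication by the quadratic form ∑ zᵢwᵢ is adjoint to the Laplacian, so harmonic polynomials are
orthogonal to its multiples. The zonal polynomial Z_y is harmonic and, modulo that form, a multiple
of a product of powers of linear forms, against which pairing is evaluation. Hence the pairing of
conj Z_x with Z_y is a positive constant times Z_y(x), and the kernel is a Gram matrix
(`fischerForm_map_conj_zonalPoly`, `posSemidef_zonalKernel`).

For constraint 6, fix a in `X` and project the code to the orthogonal complement of a. The zonal
matrices summed over (b,c) become Bᴴ K B with K a kernel matrix in dimension d - 1
(`posSemidef_sum_zonalY`). Summing over a yields N times the required matrix. -/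

/-! ### The Fischer form. -/

section Fischer

open MvPolynomial

variable {σ : Type*}

/-- The Fischer bilinear form on polynomials, for which `X^α` and `X^β` are orthogonal if `α ≠ β`
and `X^α` has square `α!`. -/
noncomputable def fischerForm (σ : Type*) :
    MvPolynomial σ ℂ →ₗ[ℂ] MvPolynomial σ ℂ →ₗ[ℂ] ℂ :=
  (basisMonomials σ ℂ).constr ℂ fun α => ((α.prod fun _ m => m ! : ℕ) : ℂ) • lcoeff ℂ α

theorem fischerForm_monomial (α : σ →₀ ℕ) (c : ℂ) (q : MvPolynomial σ ℂ) :
    fischerForm σ (monomial α c) q = c * (((α.prod fun _ m => m ! : ℕ) : ℂ) * coeff α q) := by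
  have h : monomial α c = c • basisMonomials σ ℂ α := by
    simp [coe_basisMonomials, smul_monomial]
  rw [h, map_smul, fischerForm, Module.Basis.constr_basis]
  simp

theorem fischerForm_one (q : MvPolynomial σ ℂ) : fischerForm σ 1 q = coeff 0 q := by
  have := fischerForm_monomial (0 : σ →₀ ℕ) 1 q
  simpa using this

/-- Multiplication by a variable is adjoint to differentiation, because (α + eₛ)! = (αₛ + 1) α!. -/
theorem fischerForm_X_mul (s : σ) (p q : MvPolynomial σ ℂ) :
    fischerForm σ (X s * p) q = fischerForm σ p (pderiv s q) := by
  classical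
  induction p using MvPolynomial.induction_on' with
  | monomial α c =>
    rw [X, monomial_mul, fischerForm_monomial, fischerForm_monomial, coeff_pderiv, one_mul,
      add_comm (Finsupp.single s 1) α]
    have h : ((α + Finsupp.single s 1).prod fun _ m => m !)
        = (α s + 1) * (α.prod fun _ m => m !) := by
      rw [← Finsupp.mul_prod_erase' (α + Finsupp.single s 1) s _ (by simp),
        ← Finsupp.mul_prod_erase' α s _ (by simp)]
      simp [Finsupp.erase_add, Nat.factorial_succ, mul_assoc]
    rw [h]
    push_cast
    ring
  | add p q hp hq => rw [mul_add, map_add, map_add, LinearMap.add_apply, LinearMap.add_apply, hp, hq]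

theorem fischerForm_map_conj_self_nonneg (p : MvPolynomial σ ℂ) :
    0 ≤ fischerForm σ (map (starRingEnd ℂ) p) p := by
  have h : map (starRingEnd ℂ) p = ∑ α ∈ p.support, monomial α (conj (coeff α p)) := by
    conv_lhs => rw [p.as_sum, map_sum]
    simp only [map_monomial]
  rw [h, map_sum, LinearMap.sum_apply]
  refine Finset.sum_nonneg fun α _ => ?_
  rw [fischerForm_monomial, mul_left_comm, ← Complex.normSq_eq_conj_mul_self]
  exact mul_nonneg (Nat.cast_nonneg _) (by exact_mod_cast Complex.normSq_nonneg _)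

theorem fischerForm_C_mul (c : ℂ) (p q : MvPolynomial σ ℂ) :
    fischerForm σ (C c * p) q = c * fischerForm σ p q := by
  rw [← smul_eq_C_mul, map_smul, LinearMap.smul_apply, smul_eq_mul]

end Fischer

/-! ### Bihomogeneous polynomials, adjoints and the Laplacian. -/

section Bihomogeneous

open MvPolynomial

variable {ι : Type*} [Fintype ι]

/-- The linear form with coefficients `v` in the variables indexed by the image of `e`. -/
noncomputable def linForm {σ : Type*} (e : ι → σ) (v : ι → ℂ) : MvPolynomial σ ℂ :=
  ∑ i, C (v i) * X (e i)

/-- Differentiation along `v` in the variables indexed by the image of `e`. -/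
noncomputable def dirDeriv {σ : Type*} (e : ι → σ) (v : ι → ℂ) (q : MvPolynomial σ ℂ) :
    MvPolynomial σ ℂ :=
  ∑ i, C (v i) * pderiv (e i) q

/-- The quadratic form `∑ zᵢ wᵢ`. -/
noncomputable def hermQuad (ι : Type*) [Fintype ι] : MvPolynomial (ι ⊕ ι) ℂ :=
  ∑ i, X (Sum.inl i) * X (Sum.inr i)

/-- The Laplace operator `∑ ∂²/∂zᵢ∂wᵢ`. -/
noncomputable def hermLaplacian (q : MvPolynomial (ι ⊕ ι) ℂ) : MvPolynomial (ι ⊕ ι) ℂ :=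
  ∑ i, pderiv (Sum.inr i) (pderiv (Sum.inl i) q)

theorem fischerForm_linForm_mul {σ : Type*} (e : ι → σ) (v : ι → ℂ) (p q : MvPolynomial σ ℂ) :
    fischerForm σ (linForm e v * p) q = fischerForm σ p (dirDeriv e v q) := by
  simp only [linForm, dirDeriv, Finset.sum_mul, map_sum, LinearMap.sum_apply, mul_assoc,
    fischerForm_C_mul, fischerForm_X_mul]
  simp [← smul_eq_C_mul]

theorem fischerForm_hermQuad_mul (p q : MvPolynomial (ι ⊕ ι) ℂ) :
    fischerForm _ (hermQuad ι * p) q = fischerForm _ p (hermLaplacian q) := by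
  simp only [hermQuad, hermLaplacian, Finset.sum_mul, map_sum, LinearMap.sum_apply, mul_assoc,
    fischerForm_X_mul]

/-- Bihomogeneity of degree `(k, l)`. -/
def IsBihomogeneous (q : MvPolynomial (ι ⊕ ι) ℂ) (k l : ℕ) : Prop :=
  IsWeightedHomogeneous (Sum.elim 1 0 : ι ⊕ ι → ℕ) q k ∧
    IsWeightedHomogeneous (Sum.elim 0 1 : ι ⊕ ι → ℕ) q l

theorem IsBihomogeneous.dirDeriv_inl {q : MvPolynomial (ι ⊕ ι) ℂ} {k l : ℕ}
    (h : IsBihomogeneous q (k + 1) l) (v : ι → ℂ) :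
    IsBihomogeneous (dirDeriv Sum.inl v q) k l :=
  ⟨.sum _ _ _ fun _ _ => (h.1.pderiv (by simp)).C_mul _,
    .sum _ _ _ fun _ _ => (h.2.pderiv (by simp)).C_mul _⟩

theorem IsBihomogeneous.dirDeriv_inr {q : MvPolynomial (ι ⊕ ι) ℂ} {k l : ℕ}
    (h : IsBihomogeneous q k (l + 1)) (v : ι → ℂ) :
    IsBihomogeneous (dirDeriv Sum.inr v q) k l :=
  ⟨.sum _ _ _ fun _ _ => (h.1.pderiv (by simp)).C_mul _,
    .sum _ _ _ fun _ _ => (h.2.pderiv (by simp)).C_mul _⟩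

/-- Euler's identity in the first group of variables. -/
theorem IsBihomogeneous.eval_dirDeriv_inl {q : MvPolynomial (ι ⊕ ι) ℂ} {k l : ℕ}
    (h : IsBihomogeneous q k l) (v w : ι → ℂ) :
    eval (Sum.elim v w) (dirDeriv Sum.inl v q) = k * eval (Sum.elim v w) q := by
  have := congrArg (eval (Sum.elim v w)) h.1.sum_weight_X_mul_pderiv
  simpa [Fintype.sum_sum_type, dirDeriv] using this

theorem IsBihomogeneous.eval_dirDeriv_inr {q : MvPolynomial (ι ⊕ ι) ℂ} {k l : ℕ}
    (h : IsBihomogeneous q k l) (v w : ι → ℂ) :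
    eval (Sum.elim v w) (dirDeriv Sum.inr w q) = l * eval (Sum.elim v w) q := by
  have := congrArg (eval (Sum.elim v w)) h.2.sum_weight_X_mul_pderiv
  simpa [Fintype.sum_sum_type, dirDeriv] using this

theorem IsBihomogeneous.eq_C {q : MvPolynomial (ι ⊕ ι) ℂ} (h : IsBihomogeneous q 0 0) :
    q = C (coeff 0 q) := by
  classical
  ext d
  rw [coeff_C]
  split_ifs with hd
  · rw [← hd]
  · by_contra hc
    have h1 := h.1 hc
    have h2 := h.2 hc
    rw [Finsupp.weight_apply, Finsupp.sum_fintype _ _ (by simp)] at h1 h2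
    simp only [Fintype.sum_sum_type, Sum.elim_inl, Sum.elim_inr, Pi.one_apply, Pi.zero_apply,
      smul_eq_mul, mul_one, mul_zero, Finset.sum_const_zero, add_zero, zero_add,
      Finset.sum_eq_zero_iff, Finset.mem_univ, true_imp_iff] at h1 h2
    refine hd (Finsupp.ext fun s => ?_)
    cases s with
    | inl i => exact (h1 i).symm
    | inr i => exact (h2 i).symm

/-- Evaluation of bihomogeneous polynomials is represented by products of powers of linear forms. -/
theorem IsBihomogeneous.fischerForm_linForm_pow {k l : ℕ} {q : MvPolynomial (ι ⊕ ι) ℂ}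
    (h : IsBihomogeneous q k l) (v w : ι → ℂ) :
    fischerForm _ (linForm Sum.inl v ^ k * linForm Sum.inr w ^ l) q
      = (k ! : ℂ) * (l ! : ℂ) * eval (Sum.elim v w) q := by
  -- Each linear factor crosses the form as a directional derivative, which lowers the degree by
  -- one; Euler's identity turns it into the next factor of the factorial.
  induction k generalizing q with
  | succ k ih =>
    rw [pow_succ', mul_assoc, fischerForm_linForm_mul, ih (h.dirDeriv_inl v),
      h.eval_dirDeriv_inl, Nat.factorial_succ]
    push_cast
    ring
  | zero =>
    induction l generalizing q with
    | succ l ih =>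
      rw [pow_succ' (linForm Sum.inr w), mul_left_comm, fischerForm_linForm_mul,
        ih (h.dirDeriv_inr w), h.eval_dirDeriv_inr, Nat.factorial_succ]
      push_cast
      ring
    | zero =>
      rw [pow_zero, pow_zero, one_mul, fischerForm_one]
      conv_rhs => rw [h.eq_C]
      simp

theorem isBihomogeneous_linForm_pow_mul (v w : ι → ℂ) (a b r : ℕ) :
    IsBihomogeneous (linForm Sum.inl v ^ a * linForm Sum.inr w ^ b * hermQuad ι ^ r)
      (a + r) (b + r) := by
  constructor
  · have h1 : IsWeightedHomogeneous (Sum.elim 1 0 : ι ⊕ ι → ℕ) (linForm Sum.inl v) 1 :=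
      .sum _ _ _ fun i _ => (isWeightedHomogeneous_X ℂ _ (Sum.inl i)).C_mul _
    have h2 : IsWeightedHomogeneous (Sum.elim 1 0 : ι ⊕ ι → ℕ) (linForm Sum.inr w) 0 :=
      .sum _ _ _ fun i _ => (isWeightedHomogeneous_X ℂ _ (Sum.inr i)).C_mul _
    have h3 : IsWeightedHomogeneous (Sum.elim 1 0 : ι ⊕ ι → ℕ) (hermQuad ι) 1 :=
      .sum _ _ _ fun i _ =>
        (isWeightedHomogeneous_X ℂ _ (Sum.inl i)).mul (isWeightedHomogeneous_X ℂ _ (Sum.inr i))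
    simpa using ((h1.pow a).mul (h2.pow b)).mul (h3.pow r)
  · have h1 : IsWeightedHomogeneous (Sum.elim 0 1 : ι ⊕ ι → ℕ) (linForm Sum.inl v) 0 :=
      .sum _ _ _ fun i _ => (isWeightedHomogeneous_X ℂ _ (Sum.inl i)).C_mul _
    have h2 : IsWeightedHomogeneous (Sum.elim 0 1 : ι ⊕ ι → ℕ) (linForm Sum.inr w) 1 :=
      .sum _ _ _ fun i _ => (isWeightedHomogeneous_X ℂ _ (Sum.inr i)).C_mul _
    have h3 : IsWeightedHomogeneous (Sum.elim 0 1 : ι ⊕ ι → ℕ) (hermQuad ι) 1 :=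
      .sum _ _ _ fun i _ =>
        (isWeightedHomogeneous_X ℂ _ (Sum.inl i)).mul (isWeightedHomogeneous_X ℂ _ (Sum.inr i))
    simpa using ((h1.pow a).mul (h2.pow b)).mul (h3.pow r)

/-- In the product rule, the cross terms with the quadratic form reassemble the linear forms and
contribute ar and br; differentiating its power twice contributes r(r - 1) and r times the number of
variables in each group. Truncated exponents are harmless, as their coefficients vanish. -/
theorem hermLaplacian_linForm_pow_mul (v w : ι → ℂ) (a b r : ℕ) :
    hermLaplacian (linForm Sum.inl v ^ a * linForm Sum.inr w ^ b * hermQuad ι ^ r)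
      = C ((a : ℂ) * b * ∑ i, v i * w i)
          * (linForm Sum.inl v ^ (a - 1) * linForm Sum.inr w ^ (b - 1) * hermQuad ι ^ r)
        + C ((r : ℂ) * (Fintype.card ι + a + b + r - 1))
          * (linForm Sum.inl v ^ a * linForm Sum.inr w ^ b * hermQuad ι ^ (r - 1)) := by
  classical
  have d1 (i : ι) : pderiv (Sum.inl i) (linForm Sum.inl v : MvPolynomial (ι ⊕ ι) ℂ) = C (v i) := by
    simp [linForm, pderiv_X, Pi.single_apply]
  have d2 (i : ι) : pderiv (Sum.inr i) (linForm Sum.inl v : MvPolynomial (ι ⊕ ι) ℂ) = 0 := by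
    simp [linForm, pderiv_X]
  have d3 (i : ι) : pderiv (Sum.inl i) (linForm Sum.inr w : MvPolynomial (ι ⊕ ι) ℂ) = 0 := by
    simp [linForm, pderiv_X]
  have d4 (i : ι) : pderiv (Sum.inr i) (linForm Sum.inr w : MvPolynomial (ι ⊕ ι) ℂ) = C (w i) := by
    simp [linForm, pderiv_X, Pi.single_apply]
  have d5 (i : ι) : pderiv (Sum.inl i) (hermQuad ι) = X (Sum.inr i) := by
    simp [hermQuad, pderiv_X, Pi.single_apply]
  have d6 (i : ι) : pderiv (Sum.inr i) (hermQuad ι) = X (Sum.inl i) := by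
    simp [hermQuad, pderiv_X, Pi.single_apply]
  have hp (a : ℕ) (p : MvPolynomial (ι ⊕ ι) ℂ) : (a : MvPolynomial (ι ⊕ ι) ℂ) * p ^ (a - 1) * p
      = a * p ^ a := by
    cases a with
    | zero => simp
    | succ a => rw [Nat.add_sub_cancel, pow_succ]; ring
  have hq (r : ℕ) (p : MvPolynomial (ι ⊕ ι) ℂ) : (r : MvPolynomial (ι ⊕ ι) ℂ) * (((r - 1 : ℕ) :
      MvPolynomial (ι ⊕ ι) ℂ) * p ^ (r - 1 - 1) * p) = r * (r - 1) * p ^ (r - 1) := by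
    rw [hp]
    cases r with
    | zero => simp
    | succ r => simp; ring
  set ℓ : MvPolynomial (ι ⊕ ι) ℂ := linForm Sum.inl v with hℓ
  set m : MvPolynomial (ι ⊕ ι) ℂ := linForm Sum.inr w with hm
  set N := hermQuad ι with hN
  let R := MvPolynomial (ι ⊕ ι) ℂ
  have key (i : ι) : pderiv (Sum.inr i) (pderiv (Sum.inl i) (ℓ ^ a * m ^ b * N ^ r))
      = (a : R) * (b : R) * ℓ ^ (a - 1) * m ^ (b - 1) * N ^ r * C (v i * w i)
        + (a : R) * (r : R) * ℓ ^ (a - 1) * m ^ b * N ^ (r - 1) * (C (v i) * X (Sum.inl i))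
        + (b : R) * (r : R) * ℓ ^ a * m ^ (b - 1) * N ^ (r - 1) * (C (w i) * X (Sum.inr i))
        + (r : R) * ((r - 1 : ℕ) : R) * ℓ ^ a * m ^ b * N ^ (r - 1 - 1)
          * (X (Sum.inl i) * X (Sum.inr i))
        + (r : R) * ℓ ^ a * m ^ b * N ^ (r - 1) := by
    simp only [pderiv_mul, pderiv_pow, d1, d2, d3, d4, d5, d6, map_add, pderiv_C, pderiv_X_self,
      map_mul, map_zero, Derivation.map_natCast]
    ring
  rw [hermLaplacian, Finset.sum_congr rfl fun i _ => key i]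
  simp only [Finset.sum_add_distrib, ← Finset.mul_sum, ← map_sum]
  rw [show ∑ i, C (v i) * X (Sum.inl i) = ℓ from rfl, show ∑ i, C (w i) * X (Sum.inr i) = m from rfl,
    show ∑ i, X (Sum.inl i) * X (Sum.inr i) = N from rfl]
  simp only [Finset.sum_const, Finset.card_univ, nsmul_eq_mul, map_mul, map_sub, map_add,
    map_natCast, map_one]
  linear_combination ((r : R) * m ^ b * N ^ (r - 1)) * hp a ℓ + ((r : R) * ℓ ^ a * N ^ (r - 1)) * hp b m
    + ℓ ^ a * m ^ b * hq r N

end Bihomogeneous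

/-! ### Zonal harmonics and positive definiteness of their kernel. -/

section Harmonic

open MvPolynomial

/-- The coefficient of `x^{k-r} x̄^{l-r}` in the Jacobi polynomial, up to normalization. -/
noncomputable def jacobiCoeff (n k l r : ℕ) : ℂ :=
  (-1 : ℂ) ^ r * (((n + k + l - r - 2)! : ℂ) / ((r ! : ℂ) * ((k - r)! : ℂ) * ((l - r)! : ℂ)))

theorem conj_jacobiCoeff (n k l r : ℕ) : conj (jacobiCoeff n k l r) = jacobiCoeff n k l r := by
  simp [jacobiCoeff]

theorem jacobiCoeff_zero (n k l : ℕ) :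
    jacobiCoeff n k l 0 = ((n + k + l - 2)! : ℂ) / (k ! * l !) := by
  simp [jacobiCoeff]

/-- The recurrence that makes consecutive terms of the Laplacian of `zonalPoly` cancel. -/
theorem jacobiCoeff_succ {n k l r : ℕ} (hn : 2 ≤ n) (hk : r < k) (hl : r < l) :
    jacobiCoeff n k l (r + 1) * ((r + 1 : ℂ) * (n + k + l - r - 2))
      = -(jacobiCoeff n k l r * ((k - r : ℕ) * (l - r : ℕ))) := by
  obtain ⟨k, rfl⟩ := Nat.exists_eq_add_of_lt hk
  obtain ⟨l, rfl⟩ := Nat.exists_eq_add_of_lt hl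
  obtain ⟨n, rfl⟩ := Nat.exists_eq_add_of_le hn
  have e1 : 2 + n + (r + k + 1) + (r + l + 1) - (r + 1) - 2 = n + k + l + r + 1 := by omega
  have e2 : 2 + n + (r + k + 1) + (r + l + 1) - r - 2 = n + k + l + r + 1 + 1 := by omega
  have e3 : ∀ k, r + k + 1 - (r + 1) = k := by omega
  have e4 : ∀ k, r + k + 1 - r = k + 1 := by omega
  rw [jacobiCoeff, jacobiCoeff, e1, e2, e3, e3, e4, e4, Nat.factorial_succ (n + k + l + r + 1),
    Nat.factorial_succ r, Nat.factorial_succ k, Nat.factorial_succ l]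
  have h1 : (r ! : ℂ) ≠ 0 := by exact_mod_cast r.factorial_ne_zero
  have h2 : (k ! : ℂ) ≠ 0 := by exact_mod_cast k.factorial_ne_zero
  have h3 : (l ! : ℂ) ≠ 0 := by exact_mod_cast l.factorial_ne_zero
  have h4 : (r : ℂ) + 1 ≠ 0 := by exact_mod_cast r.succ_ne_zero
  have h5 : (k : ℂ) + 1 ≠ 0 := by exact_mod_cast k.succ_ne_zero
  have h6 : (l : ℂ) + 1 ≠ 0 := by exact_mod_cast l.succ_ne_zero
  push_cast
  field_simp
  ring

variable {ι : Type*} [Fintype ι]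

/-- The zonal harmonic polynomial of bidegree `(k, l)` with pole `y`, up to normalization. -/
noncomputable def zonalPoly (k l : ℕ) (y : ι → ℂ) : MvPolynomial (ι ⊕ ι) ℂ :=
  ∑ r ∈ Finset.range (min k l + 1),
    C (jacobiCoeff (Fintype.card ι) k l r * (∑ i, y i * conj (y i)) ^ r)
      * (linForm Sum.inl y ^ (k - r) * linForm Sum.inr (fun i => conj (y i)) ^ (l - r)
        * hermQuad ι ^ r)

theorem hermLaplacian_sum_C_mul {β : Type*} (s : Finset β) (c : β → ℂ)
    (p : β → MvPolynomial (ι ⊕ ι) ℂ) :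
    hermLaplacian (∑ r ∈ s, C (c r) * p r) = ∑ r ∈ s, C (c r) * hermLaplacian (p r) := by
  simp only [hermLaplacian, map_sum, pderiv_C_mul, Finset.mul_sum]
  exact Finset.sum_comm

theorem hermLaplacian_zonalPoly (hι : 2 ≤ Fintype.card ι) (k l : ℕ) (y : ι → ℂ) :
    hermLaplacian (zonalPoly k l y) = 0 := by
  rw [zonalPoly, hermLaplacian_sum_C_mul]
  simp only [hermLaplacian_linForm_pow_mul, mul_add, Finset.sum_add_distrib]
  rw [Finset.sum_range_succ, Finset.sum_range_succ' (n := min k l)]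
  -- The sum telescopes: the last term of the first kind vanishes because r = min(k,l) kills a
  -- factor, and the r = 0 term of the second kind has coefficient 0.
  have h0 : ((k - min k l : ℕ) : ℂ) * ((l - min k l : ℕ) : ℂ) = 0 := by
    rcases le_total k l with h | h <;> simp [h]
  rw [h0]
  simp only [Nat.cast_zero, zero_mul, map_zero, mul_zero, add_zero]
  rw [← Finset.sum_add_distrib]
  refine Finset.sum_eq_zero fun r hr => ?_
  have hr := Finset.mem_range.1 hr
  have hk : r < k := by omega
  have hl : r < l := by omega
  rw [Nat.add_sub_cancel, Nat.sub_sub, Nat.sub_sub, ← mul_assoc (C _) (C _), ← mul_assoc (C _) (C _),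
    ← map_mul, ← map_mul, ← add_mul, ← map_add]
  convert zero_mul _
  refine (congrArg C ?_).trans (map_zero C)
  have h1 : ((k - (r + 1) : ℕ) : ℂ) = k - r - 1 := by
    rw [Nat.cast_sub hk]; push_cast; ring
  have h2 : ((l - (r + 1) : ℕ) : ℂ) = l - r - 1 := by
    rw [Nat.cast_sub hl]; push_cast; ring
  rw [h1, h2]
  push_cast
  linear_combination (∑ i, y i * conj (y i)) ^ (r + 1) * jacobiCoeff_succ hι hk hl

theorem isBihomogeneous_zonalPoly (k l : ℕ) (y : ι → ℂ) : IsBihomogeneous (zonalPoly k l y) k l := by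
  have h : ∀ r ∈ Finset.range (min k l + 1), k - r + r = k ∧ l - r + r = l := fun r hr => by
    have := Finset.mem_range.1 hr
    omega
  constructor
  · refine .sum _ _ _ fun r hr => ?_
    have := (isBihomogeneous_linForm_pow_mul y (fun i => conj (y i)) (k - r) (l - r) r).1
    rw [(h r hr).1] at this
    exact this.C_mul _
  · refine .sum _ _ _ fun r hr => ?_
    have := (isBihomogeneous_linForm_pow_mul y (fun i => conj (y i)) (k - r) (l - r) r).2
    rw [(h r hr).2] at this
    exact this.C_mul _

theorem map_conj_linForm {σ : Type*} (e : ι → σ) (v : ι → ℂ) :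
    map (starRingEnd ℂ) (linForm e v) = linForm e fun i => conj (v i) := by
  simp [linForm]

/-- Reproducing property: the terms r ≥ 1 on the left contain the quadratic form and are orthogonal
to harmonics; the r = 0 term evaluates. -/
theorem fischerForm_map_conj_zonalPoly (hι : 2 ≤ Fintype.card ι) (k l : ℕ) (x y : ι → ℂ) :
    fischerForm _ (map (starRingEnd ℂ) (zonalPoly k l x)) (zonalPoly k l y)
      = jacobiCoeff (Fintype.card ι) k l 0 * ((k ! : ℂ) * (l ! : ℂ))
        * eval (Sum.elim (fun i => conj (x i)) x) (zonalPoly k l y) := by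
  rw [zonalPoly, Finset.sum_range_succ', map_add, map_add, LinearMap.add_apply]
  have h : ∀ p, fischerForm _ (hermQuad ι * p) (zonalPoly k l y) = 0 := fun p => by
    rw [fischerForm_hermQuad_mul, hermLaplacian_zonalPoly hι, map_zero]
  have hN : map (starRingEnd ℂ) (hermQuad ι) = hermQuad ι := by simp [hermQuad]
  rw [map_sum, map_sum, LinearMap.sum_apply, Finset.sum_eq_zero, zero_add]
  · simp only [map_mul, map_pow, map_C, map_conj_linForm, conj_jacobiCoeff, Complex.conj_conj,
      pow_zero, mul_one, Nat.sub_zero]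
    rw [fischerForm_C_mul, (isBihomogeneous_zonalPoly k l y).fischerForm_linForm_pow]
    ring
  · intro r _
    simp only [map_mul (map _), map_pow (map _), hN]
    rw [pow_succ' (hermQuad ι), mul_left_comm _ (hermQuad ι), mul_left_comm _ (hermQuad ι), h]

/-- The zonal kernel `∑ᵣ cᵣ (xx yy)^r t^{k-r} t̄^{l-r}` as a function of `xx = ‖x‖²`, `yy = ‖y‖²`
and `t = ⟪x, y⟫`. -/
noncomputable def zonalKernel (n k l : ℕ) (xx yy t : ℂ) : ℂ :=
  ∑ r ∈ Finset.range (min k l + 1),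
    jacobiCoeff n k l r * (xx * yy) ^ r * t ^ (k - r) * conj t ^ (l - r)

theorem eval_zonalPoly (k l : ℕ) (x y : EuclideanSpace ℂ ι) :
    eval (Sum.elim (fun i => conj (x i)) x) (zonalPoly k l y)
      = zonalKernel (Fintype.card ι) k l (inner ℂ x x) (inner ℂ y y) (inner ℂ x y) := by
  have h1 : eval (Sum.elim (fun i => conj (x i)) x) (linForm Sum.inl y) = inner ℂ x y := by
    simp [linForm, PiLp.inner_apply, mul_comm]
  have h2 : eval (Sum.elim (fun i => conj (x i)) x) (linForm Sum.inr fun i => conj (y i))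
      = conj (inner ℂ x y) := by
    simp [linForm, PiLp.inner_apply, mul_comm]
  have h3 : eval (Sum.elim (fun i => conj (x i)) x) (hermQuad ι) = inner ℂ x x := by
    simp only [hermQuad, PiLp.inner_apply, map_sum, map_mul, eval_X, Sum.elim_inl, Sum.elim_inr,
      RCLike.inner_apply, mul_comm]
  have h4 : ∑ i, y i * conj (y i) = inner ℂ y y := by
    simp only [PiLp.inner_apply, RCLike.inner_apply]
  rw [zonalPoly, zonalKernel, map_sum]
  refine Finset.sum_congr rfl fun r _ => ?_
  simp only [map_mul, map_pow, eval_C, h1, h2, h3, h4]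
  ring

theorem sum_zonalKernel_nonneg_euclidean (hι : 2 ≤ Fintype.card ι) (k l : ℕ) {β : Type*}
    (s : Finset β) (y : β → EuclideanSpace ℂ ι) (w : β → ℂ) :
    0 ≤ ∑ b ∈ s, ∑ c ∈ s, conj (w b) * w c
      * zonalKernel (Fintype.card ι) k l (inner ℂ (y b) (y b)) (inner ℂ (y c) (y c))
        (inner ℂ (y b) (y c)) := by
  have h := fischerForm_map_conj_self_nonneg (∑ b ∈ s, C (w b) * zonalPoly k l (y b).ofLp)
  simp only [map_sum, map_mul, map_C, LinearMap.sum_apply, fischerForm_C_mul] at h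
  simp only [← smul_eq_C_mul, map_smul, smul_eq_mul, fischerForm_map_conj_zonalPoly hι,
    eval_zonalPoly, jacobiCoeff_zero] at h
  -- The constant of the reproducing property, positive and therefore removable.
  set κ : ℝ := (Fintype.card ι + k + l - 2)! / (k ! * l !) * (k ! * l !) with hκ
  have hκ0 : 0 < κ := by positivity
  have hκ' : ((κ : ℝ) : ℂ) = ((Fintype.card ι + k + l - 2)! : ℂ) / (k ! * l !) * (k ! * l !) := by
    rw [hκ]
    push_cast
    rfl
  rw [← hκ'] at h
  have hpos : (0 : ℂ) ≤ ((κ⁻¹ : ℝ) : ℂ) := by exact_mod_cast (inv_pos.2 hκ0).le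
  convert mul_nonneg hpos h using 1
  have hne : (κ : ℂ) ≠ 0 := by exact_mod_cast hκ0.ne'
  simp only [Finset.mul_sum]
  rw [Finset.sum_comm]
  refine Finset.sum_congr rfl fun b _ => Finset.sum_congr rfl fun c _ => ?_
  push_cast
  field_simp

theorem sum_zonalKernel_nonneg {E : Type*} [NormedAddCommGroup E] [InnerProductSpace ℂ E]
    [FiniteDimensional ℂ E] {n : ℕ} (hE : Module.finrank ℂ E = n) (hn : 2 ≤ n) (k l : ℕ)
    {β : Type*} (s : Finset β) (y : β → E) (w : β → ℂ) :
    0 ≤ ∑ b ∈ s, ∑ c ∈ s, conj (w b) * w c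
      * zonalKernel n k l (inner ℂ (y b) (y b)) (inner ℂ (y c) (y c)) (inner ℂ (y b) (y c)) := by
  subst hE
  have := sum_zonalKernel_nonneg_euclidean (ι := Fin (Module.finrank ℂ E)) (by simpa using hn) k l s
    (fun b => (stdOrthonormalBasis ℂ E).repr (y b)) w
  simpa only [LinearIsometryEquiv.inner_map_map, Fintype.card_fin] using this

theorem conj_zonalKernel_inner {E : Type*} [NormedAddCommGroup E] [InnerProductSpace ℂ E]
    (n k l : ℕ) (x y : E) :
    conj (zonalKernel n k l (inner ℂ x x) (inner ℂ y y) (inner ℂ x y))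
      = zonalKernel n k l (inner ℂ y y) (inner ℂ x x) (inner ℂ y x) := by
  simp only [zonalKernel, map_sum, map_mul, map_pow, conj_jacobiCoeff, inner_conj_symm, mul_comm]

/-- The zonal kernel is positive definite. -/
theorem posSemidef_zonalKernel {E : Type*} [NormedAddCommGroup E] [InnerProductSpace ℂ E]
    [FiniteDimensional ℂ E] {n : ℕ} (hE : Module.finrank ℂ E = n) (hn : 2 ≤ n) (k l : ℕ)
    {β : Type*} [Fintype β] (y : β → E) :
    (Matrix.of fun b c => zonalKernel n k l (inner ℂ (y b) (y b)) (inner ℂ (y c) (y c))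
      (inner ℂ (y b) (y c))).PosSemidef := by
  refine .of_dotProduct_mulVec_nonneg ?_ fun w => ?_
  · ext b c
    exact conj_zonalKernel_inner n k l (y c) (y b)
  · convert sum_zonalKernel_nonneg hE hn k l Finset.univ y w using 1
    simp only [dotProduct, Matrix.mulVec, Finset.mul_sum, Matrix.of_apply, Pi.star_apply]
    refine Finset.sum_congr rfl fun b _ => Finset.sum_congr rfl fun c _ => ?_
    rw [RCLike.star_def]
    ring

end Harmonic

/-! ### Jacobi polynomials as normalized kernels. -/

section Jacobi

/-- The normalization factor of the Jacobi polynomial. -/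
noncomputable def jacobiNorm (n k l : ℕ) : ℂ :=
  harmDim n k l * ((n - 2)! : ℂ) * (k ! : ℂ) * (l ! : ℂ)
    / (((n + k - 2)! : ℂ) * ((n + l - 2)! : ℂ))

theorem jacobiNorm_nonneg (n k l : ℕ) : 0 ≤ jacobiNorm n k l := by
  have h : (n + k - 2).choose (n - 1) * (n + l - 2).choose (n - 1)
      ≤ (n + k - 1).choose (n - 1) * (n + l - 1).choose (n - 1) :=
    Nat.mul_le_mul (Nat.choose_le_choose _ (by omega)) (Nat.choose_le_choose _ (by omega))
  have h1 : jacobiNorm n k l = (((((n + k - 1).choose (n - 1) * (n + l - 1).choose (n - 1) : ℕ) : ℝ)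
      - ((n + k - 2).choose (n - 1) * (n + l - 2).choose (n - 1) : ℕ))
      * (n - 2)! * k ! * l ! / ((n + k - 2)! * (n + l - 2)!) : ℝ) := by
    simp [jacobiNorm, harmDim]
  have h2 := sub_nonneg.2 (Nat.cast_le (α := ℝ).2 h)
  rw [h1]
  exact_mod_cast (by positivity)

theorem jacobiG_eq (n k l : ℕ) (t : ℂ) :
    jacobiG n k l t = jacobiNorm n k l * zonalKernel n k l 1 1 t := by
  simp [jacobiG, jacobiNorm, zonalKernel, jacobiCoeff]

/-- By homogeneity the square roots clear the denominators, leaving a polynomial in p, q, s and conj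
s. -/
theorem sqrt_pow_mul_jacobiG (n i j : ℕ) {p q : ℝ} (hp : 0 ≤ p) (hq : 0 ≤ q) {s : ℂ}
    (hs : p * q = 0 → s = 0) :
    ((Real.sqrt p : ℝ) : ℂ) ^ (i + j) * ((Real.sqrt q : ℝ) : ℂ) ^ (i + j)
        * jacobiG n i j (s / ((Real.sqrt (p * q) : ℝ) : ℂ))
      = jacobiNorm n i j * zonalKernel n i j p q s := by
  rw [jacobiG_eq, mul_left_comm, ← mul_pow, ← Complex.ofReal_mul, ← Real.sqrt_mul hp,
    zonalKernel, zonalKernel, Finset.mul_sum]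
  congr 1
  refine Finset.sum_congr rfl fun r hr => ?_
  have hr : r ≤ i ∧ r ≤ j := by
    have := Finset.mem_range.1 hr
    omega
  have e : ((p * q : ℝ) : ℂ) = ((Real.sqrt (p * q) : ℝ) : ℂ) ^ 2 := by
    rw [← Complex.ofReal_pow, Real.sq_sqrt (mul_nonneg hp hq)]
  rw [← Complex.ofReal_mul, e]
  obtain ⟨a, rfl⟩ := Nat.exists_eq_add_of_le hr.1
  obtain ⟨b, rfl⟩ := Nat.exists_eq_add_of_le hr.2
  rw [Nat.add_sub_cancel_left, Nat.add_sub_cancel_left]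
  -- Here the quotient is 0/0 = 0, and both summands vanish unless i = j = r = 0.
  by_cases h : p * q = 0
  · rw [hs h, h]
    rcases Nat.eq_zero_or_pos a with rfl | ha
    · rcases Nat.eq_zero_or_pos b with rfl | hb
      · rcases Nat.eq_zero_or_pos r with rfl | hr
        · simp
        · simp [hr.ne']
      · simp [hb.ne']
    · simp [ha.ne']
  · have h0 : ((Real.sqrt (p * q) : ℝ) : ℂ) ≠ 0 := by
      rw [Complex.ofReal_ne_zero, Real.sqrt_ne_zero (mul_nonneg hp hq)]
      exact h
    rw [map_div₀, Complex.conj_ofReal, div_pow, div_pow]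
    generalize ((Real.sqrt (p * q) : ℝ) : ℂ) = ρ at h0 ⊢
    rw [show r + a + (r + b) = r + r + a + b by ring, pow_add, pow_add, pow_add]
    field_simp
    ring

end Jacobi

/-! ### Projection away from a point of the code. -/

section Projection

variable {E : Type*} [NormedAddCommGroup E] [InnerProductSpace ℂ E]

/-- The component of `b` orthogonal to a unit vector `a`. -/
noncomputable def orthComponent (a b : E) (ha : inner ℂ a a = (1 : ℂ)) : (ℂ ∙ a)ᗮ :=
  ⟨b - inner ℂ a b • a, by
    rw [Submodule.mem_orthogonal_singleton_iff_inner_right, inner_sub_right, inner_smul_right, ha,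
      mul_one, sub_self]⟩

theorem inner_orthComponent (a b c : E) (ha : inner ℂ a a = (1 : ℂ)) :
    inner ℂ (orthComponent a b ha) (orthComponent a c ha)
      = inner ℂ b c - conj (inner ℂ a b) * inner ℂ a c := by
  simp only [orthComponent, Submodule.coe_inner, inner_sub_left, inner_sub_right, inner_smul_left,
    inner_smul_right, ha, inner_conj_symm]
  ring

theorem inner_orthComponent_self (a b : E) (ha : inner ℂ a a = (1 : ℂ))
    (hb : inner ℂ b b = (1 : ℂ)) :
    inner ℂ (orthComponent a b ha) (orthComponent a b ha)
      = ((1 - Complex.normSq (inner ℂ a b) : ℝ) : ℂ) := by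
  rw [inner_orthComponent, hb, ← Complex.normSq_eq_conj_mul_self]
  push_cast
  rfl

theorem zonalY_inner_apply (d k l i j : ℕ) {a b c : E} (ha : inner ℂ a a = (1 : ℂ))
    (hb : inner ℂ b b = (1 : ℂ)) (hc : inner ℂ c c = (1 : ℂ))
    (p q : Fin (zonalMult k l i j + 1)) :
    zonalY d k l i j (inner ℂ a b) (inner ℂ a c) (inner ℂ b c) p q
      = jacobiNorm (d - 1) i j *
        (conj ((inner ℂ a b * conj (inner ℂ a b)) ^ (p : ℕ))
          * zonalKernel (d - 1) i j
            (inner ℂ (orthComponent a b ha) (orthComponent a b ha))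
            (inner ℂ (orthComponent a c ha) (orthComponent a c ha))
            (inner ℂ (orthComponent a b ha) (orthComponent a c ha))
          * (inner ℂ a c * conj (inner ℂ a c)) ^ (q : ℕ)) := by
  -- As a squared norm this is nonnegative, and it vanishes only if the projection does, which
  -- forces t = ūv.
  have hself (b : E) (hb : inner ℂ b b = (1 : ℂ)) :
      1 - Complex.normSq (inner ℂ a b) = ‖orthComponent a b ha‖ ^ 2 := by
    have h := inner_orthComponent_self a b ha hb
    rw [inner_self_eq_norm_sq_to_K] at h
    apply Complex.ofReal_injective
    rw [← h]
    simp
  have h := sqrt_pow_mul_jacobiG (d - 1) i j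
    (p := 1 - Complex.normSq (inner ℂ a b)) (q := 1 - Complex.normSq (inner ℂ a c))
    (s := inner ℂ b c - conj (inner ℂ a b) * inner ℂ a c)
    (by rw [hself b hb]; positivity) (by rw [hself c hc]; positivity) (fun h0 => by
      rw [hself b hb, hself c hc] at h0
      rw [← inner_orthComponent a b c ha]
      rcases mul_eq_zero.1 h0 with h0 | h0
      · rw [norm_eq_zero.1 (pow_eq_zero_iff two_ne_zero |>.1 h0), inner_zero_left]
      · rw [norm_eq_zero.1 (pow_eq_zero_iff two_ne_zero |>.1 h0), inner_zero_right])
  rw [inner_orthComponent_self a b ha hb, inner_orthComponent_self a c ha hc, inner_orthComponent]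
  simp only [zonalY, Matrix.of_apply, map_pow, map_mul, Complex.conj_conj]
  linear_combination (inner ℂ a b * conj (inner ℂ a b)) ^ (p : ℕ)
    * (inner ℂ a c * conj (inner ℂ a c)) ^ (q : ℕ) * h

theorem posSemidef_sum_zonalY [FiniteDimensional ℂ E] {d : ℕ} (hd : 3 ≤ d)
    (hE : Module.finrank ℂ E = d) (k l i j : ℕ) {a : E} (ha : inner ℂ a a = (1 : ℂ))
    (X : Finset E) (hX : ∀ b ∈ X, inner ℂ b b = (1 : ℂ)) :
    (∑ b ∈ X, ∑ c ∈ X,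
      zonalY d k l i j (inner ℂ a b) (inner ℂ a c) (inner ℂ b c)).PosSemidef := by
  -- The complement has dimension d - 1 ≥ 2, as the kernel lemma requires; this uses d ≥ 3.
  have hfin : Module.finrank ℂ (ℂ ∙ a)ᗮ = d - 1 := by
    have : Fact (Module.finrank ℂ E = (d - 1) + 1) := ⟨by omega⟩
    exact Submodule.finrank_orthogonal_span_singleton (by rintro rfl; simp at ha)
  have hK := posSemidef_zonalKernel hfin (by omega) i j fun b : X => orthComponent a (b : E) ha
  let B : Matrix X (Fin (zonalMult k l i j + 1)) ℂ :=
    Matrix.of fun b q => (inner ℂ a (b : E) * conj (inner ℂ a (b : E))) ^ (q : ℕ)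
  convert (hK.conjTranspose_mul_mul_same B).smul (jacobiNorm_nonneg (d - 1) i j) using 1
  ext p q
  rw [← Finset.sum_coe_sort X, Finset.sum_congr rfl fun b _ => (Finset.sum_coe_sort X _).symm]
  simp only [Matrix.sum_apply, Matrix.smul_apply, Matrix.mul_apply, Finset.sum_mul, smul_eq_mul,
    Finset.mul_sum]
  rw [Finset.sum_comm]
  refine Finset.sum_congr rfl fun c _ => Finset.sum_congr rfl fun b _ => ?_
  rw [zonalY_inner_apply d k l i j ha (hX b b.2) (hX c c.2)]
  rfl

theorem sum_jacobiG_nonneg [FiniteDimensional ℂ E] {d : ℕ} (hd : 2 ≤ d)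
    (hE : Module.finrank ℂ E = d) (k l : ℕ)
    (X : Finset E) (hX : ∀ b ∈ X, inner ℂ b b = (1 : ℂ)) :
    0 ≤ ∑ a ∈ X, ∑ b ∈ X, jacobiG d k l (inner ℂ a b) := by
  have h := mul_nonneg (jacobiNorm_nonneg d k l)
    (sum_zonalKernel_nonneg hE hd k l X id fun _ => 1)
  convert h using 1
  simp only [Finset.mul_sum]
  refine Finset.sum_congr rfl fun a ha => Finset.sum_congr rfl fun b hb => ?_
  simp only [id, map_one, one_mul, hX a ha, hX b hb, jacobiG_eq]

end Projection

/-! ### Counting triples by type. -/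

section TripleDistribution

/-- Sorting `T` by the value of `τ`; only the finitely many attained values contribute, so `S` may
be infinite. -/
theorem finsum_mem_card_fiber_smul {α β M : Type*} [AddCommMonoid M] [DecidableEq β]
    (T : Finset α) (τ : α → β) (S : Set β) [DecidablePred (· ∈ S)] (F : β → M) :
    ∑ᶠ p ∈ S, (T.filter fun t => τ t = p).card • F p
      = ∑ t ∈ T, if τ t ∈ S then F (τ t) else 0 := by
  rw [← Finset.sum_filter, Finset.sum_comp F τ,
    finsum_mem_eq_sum_of_subset (t := (T.filter fun t => τ t ∈ S).image τ)]
  · refine Finset.sum_congr rfl fun p hp => ?_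
    obtain ⟨t, ht, rfl⟩ := Finset.mem_image.1 hp
    congr 2
    ext t'
    simp only [Finset.mem_filter]
    constructor
    · rintro ⟨h, h'⟩
      exact ⟨⟨h, h' ▸ (Finset.mem_filter.1 ht).2⟩, h'⟩
    · rintro ⟨⟨h, -⟩, h'⟩
      exact ⟨h, h'⟩
  · rintro p ⟨hp, hp'⟩
    have : (T.filter fun t => τ t = p).card ≠ 0 := fun h => hp' (by simp only [h, zero_smul])
    obtain ⟨t, ht⟩ := Finset.card_ne_zero.1 this
    obtain ⟨hT, rfl⟩ := Finset.mem_filter.1 ht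
    simp only [Finset.coe_image, Set.mem_image, Finset.mem_coe, Finset.mem_filter]
    exact ⟨t, ⟨hT, hp⟩, rfl⟩
  · intro p hp
    simp only [Finset.coe_image, Set.mem_image, Finset.mem_coe, Finset.mem_filter] at hp
    obtain ⟨t, ⟨-, ht⟩, rfl⟩ := hp
    exact ht

variable {d : ℕ}

/-- The inner products of a triple of vectors. -/
noncomputable def tripleType (t : EuclideanSpace ℂ (Fin d) × EuclideanSpace ℂ (Fin d) ×
    EuclideanSpace ℂ (Fin d)) : ℂ × ℂ × ℂ :=
  (inner ℂ t.1 t.2.1, inner ℂ t.1 t.2.2, inner ℂ t.2.1 t.2.2)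

open Classical in
/-- The number of triples in `X` with given inner products. -/
noncomputable def tripleCount (X : Finset (EuclideanSpace ℂ (Fin d))) (p : ℂ × ℂ × ℂ) : ℕ :=
  ((X ×ˢ X ×ˢ X).filter fun t => tripleType t = p).card

theorem tripleCount_le_of_equiv (X : Finset (EuclideanSpace ℂ (Fin d))) (p q : ℂ × ℂ × ℂ)
    (e : EuclideanSpace ℂ (Fin d) × EuclideanSpace ℂ (Fin d) × EuclideanSpace ℂ (Fin d) →
      EuclideanSpace ℂ (Fin d) × EuclideanSpace ℂ (Fin d) × EuclideanSpace ℂ (Fin d))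
    (he : Function.Injective e) (hX : ∀ t ∈ X ×ˢ X ×ˢ X, e t ∈ X ×ˢ X ×ˢ X)
    (hp : ∀ t ∈ X ×ˢ X ×ˢ X, tripleType t = p → tripleType (e t) = q) :
    tripleCount X p ≤ tripleCount X q := by
  classical
  refine Finset.card_le_card_of_injOn e (fun t ht => ?_) he.injOn
  simp only [Finset.coe_filter, Set.mem_ofPred_eq] at ht ⊢
  exact ⟨hX t ht.1, hp t ht.1 ht.2⟩

/-- Together with `tripleCount_swap_fst` this generates all permutations of the three points. -/
theorem tripleCount_swap_snd (X : Finset (EuclideanSpace ℂ (Fin d))) (u v t : ℂ) :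
    tripleCount X (u, v, t) = tripleCount X (v, u, conj t) := by
  have h : ∀ u v t, tripleCount X (u, v, t) ≤ tripleCount X (v, u, conj t) := fun u v t =>
    tripleCount_le_of_equiv X _ _ (fun s => (s.1, s.2.2, s.2.1))
      (by rintro ⟨a, b, c⟩ ⟨a', b', c'⟩ h; simp_all)
      (by simp only [Finset.mem_product]; tauto)
      (by
        simp only [tripleType, Prod.mk.injEq]
        rintro s - ⟨rfl, rfl, rfl⟩
        simp)
  refine le_antisymm (h u v t) ((h _ _ _).trans_eq ?_)
  rw [Complex.conj_conj]

theorem tripleCount_swap_fst (X : Finset (EuclideanSpace ℂ (Fin d))) (u v t : ℂ) :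
    tripleCount X (u, v, t) = tripleCount X (conj u, t, v) := by
  have h : ∀ u v t, tripleCount X (u, v, t) ≤ tripleCount X (conj u, t, v) := fun u v t =>
    tripleCount_le_of_equiv X _ _ (fun s => (s.2.1, s.1, s.2.2))
      (by rintro ⟨a, b, c⟩ ⟨a', b', c'⟩ h; simp_all)
      (by simp only [Finset.mem_product]; tauto)
      (by
        simp only [tripleType, Prod.mk.injEq]
        rintro s - ⟨rfl, rfl, rfl⟩
        simp)
  refine le_antisymm (h u v t) ((h _ _ _).trans_eq ?_)
  rw [Complex.conj_conj]

end TripleDistribution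

/-! ### Feasibility of the triple distribution. -/

section Code

variable {d : ℕ} {A : Set ℂ} {X : Finset (EuclideanSpace ℂ (Fin d))}

theorem inner_self_of_subset_unitSphere
    (hX : (X : Set (EuclideanSpace ℂ (Fin d))) ⊆ unitSphere d)
    {a : EuclideanSpace ℂ (Fin d)} (ha : a ∈ X) : inner ℂ a a = (1 : ℂ) :=
  hX ha

/-- Since 1 is not in `A`, the inner product alone decides whether two code points coincide. -/
theorem inner_mem_iff_ne (hA : A ⊆ Metric.closedBall (0 : ℂ) 1 \ {1})
    (hX : (X : Set (EuclideanSpace ℂ (Fin d))) ⊆ unitSphere d)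
    (hXA : innerProductSet (X : Set (EuclideanSpace ℂ (Fin d))) ⊆ A)
    {a b : EuclideanSpace ℂ (Fin d)} (ha : a ∈ X) (hb : b ∈ X) :
    inner ℂ a b ∈ A ↔ a ≠ b := by
  refine ⟨?_, fun h => hXA ⟨a, ha, b, hb, h, rfl⟩⟩
  rintro h rfl
  rw [inner_self_of_subset_unitSphere hX ha] at h
  exact (hA h).2 rfl

theorem inner_eq_one_iff_eq (hA : A ⊆ Metric.closedBall (0 : ℂ) 1 \ {1})
    (hX : (X : Set (EuclideanSpace ℂ (Fin d))) ⊆ unitSphere d)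
    (hXA : innerProductSet (X : Set (EuclideanSpace ℂ (Fin d))) ⊆ A)
    {a b : EuclideanSpace ℂ (Fin d)} (ha : a ∈ X) (hb : b ∈ X) :
    inner ℂ a b = (1 : ℂ) ↔ a = b := by
  constructor
  · intro h
    by_contra hne
    have := (inner_mem_iff_ne hA hX hXA ha hb).2 hne
    rw [h] at this
    exact (hA this).2 rfl
  · rintro rfl
    exact inner_self_of_subset_unitSphere hX ha

theorem posSemidef_gramMatrix_inner {a b c : EuclideanSpace ℂ (Fin d)}
    (ha : inner ℂ a a = (1 : ℂ)) (hb : inner ℂ b b = (1 : ℂ)) (hc : inner ℂ c c = (1 : ℂ)) :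
    (gramMatrix (inner ℂ a b) (inner ℂ a c) (inner ℂ b c)).PosSemidef := by
  have h : gramMatrix (inner ℂ a b) (inner ℂ a c) (inner ℂ b c) = Matrix.gram ℂ ![a, b, c] := by
    ext i j
    fin_cases i <;> fin_cases j <;>
      simp [gramMatrix, Matrix.gram, -inner_self_eq_norm_sq_to_K, ha, hb, hc]
  rw [h]
  exact Matrix.posSemidef_gram ℂ _

theorem tripleType_mem_tripleSet_iff (hA : A ⊆ Metric.closedBall (0 : ℂ) 1 \ {1})
    (hX : (X : Set (EuclideanSpace ℂ (Fin d))) ⊆ unitSphere d)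
    (hXA : innerProductSet (X : Set (EuclideanSpace ℂ (Fin d))) ⊆ A)
    {a b c : EuclideanSpace ℂ (Fin d)} (ha : a ∈ X) (hb : b ∈ X) (hc : c ∈ X) :
    tripleType (a, b, c) ∈ tripleSet A ↔ a ≠ b ∧ a ≠ c ∧ b ≠ c := by
  have h1 := inner_self_of_subset_unitSphere hX ha
  have h2 := inner_self_of_subset_unitSphere hX hb
  have h3 := inner_self_of_subset_unitSphere hX hc
  simp only [tripleSet, tripleType, Set.mem_ofPred_eq, inner_mem_iff_ne hA hX hXA ha hb,
    inner_mem_iff_ne hA hX hXA ha hc, inner_mem_iff_ne hA hX hXA hb hc,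
    posSemidef_gramMatrix_inner h1 h2 h3, and_true]

theorem tripleType_mem_image_iff (hA : A ⊆ Metric.closedBall (0 : ℂ) 1 \ {1})
    (hX : (X : Set (EuclideanSpace ℂ (Fin d))) ⊆ unitSphere d)
    (hXA : innerProductSet (X : Set (EuclideanSpace ℂ (Fin d))) ⊆ A)
    {a b c : EuclideanSpace ℂ (Fin d)} (ha : a ∈ X) (hb : b ∈ X) (hc : c ∈ X) :
    tripleType (a, b, c) ∈ (fun u : ℂ => (u, u, (1 : ℂ))) '' A ↔ b = c ∧ a ≠ b := by
  simp only [tripleType, Set.mem_image, Prod.mk.injEq]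
  constructor
  · rintro ⟨u, hu, h1, -, h3⟩
    rw [h1, inner_mem_iff_ne hA hX hXA ha hb] at hu
    exact ⟨(inner_eq_one_iff_eq hA hX hXA hb hc).1 h3.symm, hu⟩
  · rintro ⟨rfl, h⟩
    exact ⟨_, (inner_mem_iff_ne hA hX hXA ha hb).2 h, rfl, rfl,
      (inner_self_of_subset_unitSphere hX hb).symm⟩

theorem tripleType_mem_union_iff (hA : A ⊆ Metric.closedBall (0 : ℂ) 1 \ {1})
    (hX : (X : Set (EuclideanSpace ℂ (Fin d))) ⊆ unitSphere d)
    (hXA : innerProductSet (X : Set (EuclideanSpace ℂ (Fin d))) ⊆ A)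
    {a b c : EuclideanSpace ℂ (Fin d)} (ha : a ∈ X) (hb : b ∈ X) (hc : c ∈ X) :
    tripleType (a, b, c) ∈ tripleSet A ∪ degenerateSet A ↔ ¬(a = b ∧ b = c) := by
  have h1 : tripleType (a, b, c) ∈ degenerateSet A ↔
      (b = c ∧ a ≠ b) ∨ (a = c ∧ a ≠ b) ∨ (a = b ∧ a ≠ c) := by
    simp only [degenerateSet, tripleType, Set.mem_union, Set.mem_ofPred_eq, Prod.mk.injEq, or_assoc]
    refine or_congr ?_ (or_congr ?_ ?_)
    · rw [← tripleType_mem_image_iff hA hX hXA ha hb hc]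
      simp only [tripleType, Set.mem_image, Prod.mk.injEq, eq_comm]
    · constructor
      · rintro ⟨u, hu, h1, h2, -⟩
        rw [← h1, inner_mem_iff_ne hA hX hXA ha hb] at hu
        exact ⟨(inner_eq_one_iff_eq hA hX hXA ha hc).1 h2, hu⟩
      · rintro ⟨rfl, h⟩
        exact ⟨_, (inner_mem_iff_ne hA hX hXA ha hb).2 h, rfl,
          inner_self_of_subset_unitSphere hX ha, (inner_conj_symm _ _).symm⟩
    · constructor
      · rintro ⟨u, hu, h1, h2, -⟩
        rw [← h2, inner_mem_iff_ne hA hX hXA ha hc] at hu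
        exact ⟨(inner_eq_one_iff_eq hA hX hXA ha hb).1 h1, hu⟩
      · rintro ⟨rfl, h⟩
        exact ⟨_, (inner_mem_iff_ne hA hX hXA ha hc).2 h,
          inner_self_of_subset_unitSphere hX ha, rfl, rfl⟩
  rw [Set.mem_union, tripleType_mem_tripleSet_iff hA hX hXA ha hb hc, h1]
  grind

open Classical in
theorem finsum_tripleCount_smul {M : Type*} [AddCommMonoid M] (S : Set (ℂ × ℂ × ℂ))
    (F : ℂ × ℂ × ℂ → M) :
    ∑ᶠ p ∈ S, tripleCount X p • F p
      = ∑ a ∈ X, ∑ b ∈ X, ∑ c ∈ X,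
        if tripleType (a, b, c) ∈ S then F (tripleType (a, b, c)) else 0 := by
  simp only [tripleCount, finsum_mem_card_fiber_smul, Finset.sum_product]

open Classical in
theorem finsum_tripleCount_pair_smul (hA : A ⊆ Metric.closedBall (0 : ℂ) 1 \ {1})
    (hX : (X : Set (EuclideanSpace ℂ (Fin d))) ⊆ unitSphere d)
    (hXA : innerProductSet (X : Set (EuclideanSpace ℂ (Fin d))) ⊆ A)
    {M : Type*} [AddCommMonoid M] (F : ℂ → M) :
    ∑ᶠ u ∈ A, tripleCount X (u, u, 1) • F u
      = ∑ a ∈ X, ∑ b ∈ X, if a = b then 0 else F (inner ℂ a b) := by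
  have h := finsum_mem_image (s := A) (g := fun u : ℂ => (u, u, (1 : ℂ)))
    (f := fun p => tripleCount X p • F p.1) (fun u _ v _ h => (Prod.mk.inj h).1)
  rw [← h, finsum_tripleCount_smul]
  refine Finset.sum_congr rfl fun a ha => Finset.sum_congr rfl fun b hb => ?_
  rw [Finset.sum_congr rfl fun c hc => by rw [tripleType_mem_image_iff hA hX hXA ha hb hc]]
  by_cases hab : a = b
  · simp [hab]
  · simp [hab, hb, tripleType]

open Classical in
-- Triples with a = b = c supply the constant term of the program; all others have type in D ∪ D₀.
theorem add_finsum_tripleCount_smul (hA : A ⊆ Metric.closedBall (0 : ℂ) 1 \ {1})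
    (hX : (X : Set (EuclideanSpace ℂ (Fin d))) ⊆ unitSphere d)
    (hXA : innerProductSet (X : Set (EuclideanSpace ℂ (Fin d))) ⊆ A)
    {M : Type*} [AddCommMonoid M] (F : ℂ × ℂ × ℂ → M) :
    X.card • F (1, 1, 1) + ∑ᶠ p ∈ tripleSet A ∪ degenerateSet A, tripleCount X p • F p
      = ∑ a ∈ X, ∑ b ∈ X, ∑ c ∈ X, F (tripleType (a, b, c)) := by
  have h : ∑ a ∈ X, ∑ b ∈ X, ∑ c ∈ X, (if a = b ∧ b = c then F (tripleType (a, b, c)) else 0)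
      = X.card • F (1, 1, 1) := by
    rw [← Finset.sum_const]
    refine Finset.sum_congr rfl fun a ha => ?_
    have h1 := inner_self_of_subset_unitSphere hX ha
    rw [Finset.sum_eq_single a (fun b _ hb => by simp [hb.symm]) (fun h => (h ha).elim),
      Finset.sum_eq_single a (fun b _ hb => by simp [hb.symm]) (fun h => (h ha).elim)]
    simp only [and_self, if_true, tripleType, h1]
  rw [finsum_tripleCount_smul, ← h]
  simp only [← Finset.sum_add_distrib]
  refine Finset.sum_congr rfl fun a ha => Finset.sum_congr rfl fun b hb =>
    Finset.sum_congr rfl fun c hc => ?_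
  rw [tripleType_mem_union_iff hA hX hXA ha hb hc]
  by_cases h : a = b ∧ b = c
  · rw [if_pos h, if_neg (not_not.2 h), add_zero]
  · rw [if_neg h, if_pos h, zero_add]

/-- The three-point distance distribution of `X`. -/
noncomputable def tripleDistribution (X : Finset (EuclideanSpace ℂ (Fin d))) (p : ℂ × ℂ × ℂ) : ℝ :=
  (tripleCount X p : ℝ) / X.card

theorem finsum_tripleDistribution_pair (hA : A ⊆ Metric.closedBall (0 : ℂ) 1 \ {1})
    (hX : (X : Set (EuclideanSpace ℂ (Fin d))) ⊆ unitSphere d)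
    (hXA : innerProductSet (X : Set (EuclideanSpace ℂ (Fin d))) ⊆ A) (hne : X.Nonempty) :
    ∑ᶠ u ∈ A, tripleDistribution X (u, u, 1) = (X.card : ℝ) - 1 := by
  classical
  have h0 : (X.card : ℝ) ≠ 0 := by exact_mod_cast hne.card_ne_zero
  have h := finsum_tripleCount_pair_smul hA hX hXA fun _ => (X.card : ℝ)⁻¹
  simp only [nsmul_eq_mul, ← div_eq_mul_inv] at h
  refine h.trans ?_
  have h2 : ∀ a ∈ X, (∑ b ∈ X, if a = b then 0 else (X.card : ℝ)⁻¹)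
      = (X.card : ℝ)⁻¹ * (X.card - 1) := fun a ha => by
    have : ∀ b, (if a = b then 0 else (X.card : ℝ)⁻¹)
        = (X.card : ℝ)⁻¹ - if a = b then (X.card : ℝ)⁻¹ else 0 := fun b => by split_ifs <;> simp
    simp only [this, Finset.sum_sub_distrib, Finset.sum_const, Finset.sum_ite_eq, ha, if_true,
      nsmul_eq_mul]
    ring
  rw [Finset.sum_congr rfl h2, Finset.sum_const, nsmul_eq_mul]
  field_simp

theorem finsum_tripleDistribution_tripleSet (hA : A ⊆ Metric.closedBall (0 : ℂ) 1 \ {1})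
    (hX : (X : Set (EuclideanSpace ℂ (Fin d))) ⊆ unitSphere d)
    (hXA : innerProductSet (X : Set (EuclideanSpace ℂ (Fin d))) ⊆ A) (hne : X.Nonempty) :
    ∑ᶠ p ∈ tripleSet A, tripleDistribution X p = ((X.card : ℝ) - 1) * (X.card - 2) := by
  classical
  have h0 : (X.card : ℝ) ≠ 0 := by exact_mod_cast hne.card_ne_zero
  have h := finsum_tripleCount_smul (X := X) (tripleSet A) fun _ => (X.card : ℝ)⁻¹
  simp only [nsmul_eq_mul, ← div_eq_mul_inv] at h
  refine h.trans ?_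
  -- Inclusion–exclusion for the indicator of pairwise distinct points.
  have h2 : ∀ a ∈ X, ∀ b ∈ X, ∀ c ∈ X,
      (if tripleType (a, b, c) ∈ tripleSet A then (X.card : ℝ)⁻¹ else 0)
      = (X.card : ℝ)⁻¹ * (1 - (if a = b then 1 else 0) - (if a = c then 1 else 0)
        - (if b = c then 1 else 0) + 2 * if a = b then (if b = c then 1 else 0) else 0) :=
    fun a ha b hb c hc => by
      rw [tripleType_mem_tripleSet_iff hA hX hXA ha hb hc]
      by_cases hab : a = b
      · subst hab
        by_cases hac : a = c <;> simp [hac]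
        norm_num
      · by_cases hac : a = c
        · subst hac
          simp [hab, Ne.symm hab]
        · by_cases hbc : b = c <;> simp [hab, hac, hbc]
  rw [Finset.sum_congr rfl fun a ha => Finset.sum_congr rfl fun b hb =>
    Finset.sum_congr rfl fun c hc => h2 a ha b hb c hc]
  simp only [← Finset.mul_sum, Finset.sum_add_distrib, Finset.sum_sub_distrib, Finset.sum_const,
    nsmul_eq_mul, mul_one]
  have h3 : ∑ a ∈ X, ∑ c ∈ X, (if a = c then (1 : ℝ) else 0) = X.card := by
    rw [Finset.sum_congr rfl fun a ha => (Finset.sum_ite_eq X a _).trans (if_pos ha)]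
    simp
  have h4 : ∑ a ∈ X, ∑ b ∈ X, ∑ c ∈ X, (if a = b then (if b = c then (1 : ℝ) else 0) else 0)
      = X.card := by
    rw [← h3]
    refine Finset.sum_congr rfl fun a ha => ?_
    rw [Finset.sum_eq_single a (fun b _ hb => by simp [hb.symm]) (fun h => (h ha).elim)]
    simp
  rw [h4, h3]
  field_simp
  ring

/-- The map (a,b,b) ↦ (b,a,a) is not a permutation of coordinates, so it needs its own injection. -/
theorem tripleCount_swap_pair_le (hA : A ⊆ Metric.closedBall (0 : ℂ) 1 \ {1})
    (hX : (X : Set (EuclideanSpace ℂ (Fin d))) ⊆ unitSphere d)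
    (hXA : innerProductSet (X : Set (EuclideanSpace ℂ (Fin d))) ⊆ A) (u : ℂ) :
    tripleCount X (u, u, 1) ≤ tripleCount X (conj u, conj u, 1) := by
  classical
  have key : ∀ t ∈ (X ×ˢ X ×ˢ X).filter fun t => tripleType t = (u, u, 1),
      t.1 ∈ X ∧ t.2.1 ∈ X ∧ t.2.1 = t.2.2 ∧ inner ℂ t.1 t.2.1 = u := by
    intro t ht
    simp only [Finset.mem_filter, Finset.mem_product, tripleType, Prod.mk.injEq] at ht
    obtain ⟨⟨h1, h2, h3⟩, h4, -, h5⟩ := ht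
    exact ⟨h1, h2, (inner_eq_one_iff_eq hA hX hXA h2 h3).1 h5, h4⟩
  refine Finset.card_le_card_of_injOn (fun t => (t.2.1, t.1, t.1)) (fun t ht => ?_) ?_
  · obtain ⟨h1, h2, -, h4⟩ := key t ht
    simp only [Finset.coe_filter, Set.mem_ofPred_eq, Finset.mem_product, tripleType, Prod.mk.injEq]
    have h5 : conj u = inner ℂ t.2.1 t.1 := by rw [← h4, inner_conj_symm]
    exact ⟨⟨h2, h1, h1⟩, h5.symm, h5.symm, inner_self_of_subset_unitSphere hX h1⟩
  · rintro ⟨a, b, c⟩ ht ⟨a', b', c'⟩ ht' h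
    have h1 := (key _ ht).2.2.1
    have h2 := (key _ ht').2.2.1
    simp_all

theorem tripleCount_swap_pair (hA : A ⊆ Metric.closedBall (0 : ℂ) 1 \ {1})
    (hX : (X : Set (EuclideanSpace ℂ (Fin d))) ⊆ unitSphere d)
    (hXA : innerProductSet (X : Set (EuclideanSpace ℂ (Fin d))) ⊆ A) (u : ℂ) :
    tripleCount X (u, u, 1) = tripleCount X (conj u, conj u, 1) := by
  refine le_antisymm (tripleCount_swap_pair_le hA hX hXA u)
    ((tripleCount_swap_pair_le hA hX hXA _).trans_eq ?_)
  rw [Complex.conj_conj]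

theorem sdpFeasible_tripleDistribution (hd : 3 ≤ d) (hA : A ⊆ Metric.closedBall (0 : ℂ) 1 \ {1})
    (hX : (X : Set (EuclideanSpace ℂ (Fin d))) ⊆ unitSphere d)
    (hXA : innerProductSet (X : Set (EuclideanSpace ℂ (Fin d))) ⊆ A) (hne : X.Nonempty) :
    SDPFeasible d A (tripleDistribution X) where
  symm u v t _ := by
    have h1 := tripleCount_swap_snd X
    have h2 := tripleCount_swap_fst X
    simp only [tripleDistribution]
    exact ⟨by rw [← h1], by rw [h2 u v t, h1 (conj u) t v, h2 t], by rw [h1 u v t, h2 v], by rw [← h2],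
      by rw [h2 u v t, h1 (conj u)]⟩
  symm_degenerate u _ := by
    have h1 := tripleCount_swap_snd X
    have h2 := tripleCount_swap_fst X
    have h3 := tripleCount_swap_pair hA hX hXA
    simp only [tripleDistribution]
    have h4 : tripleCount X (u, 1, conj u) = tripleCount X (conj u, 1, u) := by
      rw [h2 u 1 (conj u), ← h3, h2 (conj u) 1 u, Complex.conj_conj]
    refine ⟨by rw [← h3], by rw [h4], ?_⟩
    rw [h1 1 u u, h1 1 (conj u) (conj u), Complex.conj_conj, h4]
  nonneg p _ := by unfold tripleDistribution; positivity
  finite := by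
    classical
    refine ((X ×ˢ X ×ˢ X).image tripleType).finite_toSet.subset ?_
    rintro p ⟨-, hp⟩
    have : tripleCount X p ≠ 0 := fun h => hp (by simp [tripleDistribution, h])
    obtain ⟨t, ht⟩ := Finset.card_ne_zero.1 this
    obtain ⟨hT, rfl⟩ := Finset.mem_filter.1 ht
    exact Finset.mem_coe.2 (Finset.mem_image_of_mem _ hT)
  counting := by
    rw [finsum_tripleDistribution_pair hA hX hXA hne,
      finsum_tripleDistribution_tripleSet hA hX hXA hne]
    -- The corner entry is (N - 1) + (N - 1)(N - 2) = (N - 1)².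
    convert Matrix.posSemidef_vecMulVec_self_star ![(1 : ℝ), X.card - 1] using 1
    ext i j
    fin_cases i <;> fin_cases j <;> simp [Matrix.vecMulVec]
    ring
  linear k l := by
    classical
    have h0 : (X.card : ℂ) ≠ 0 := by exact_mod_cast hne.card_ne_zero
    have h := finsum_tripleCount_pair_smul hA hX hXA fun u => (X.card : ℂ)⁻¹ * jacobiG d k l u
    have h1 : ∀ u, ((tripleDistribution X (u, u, 1) : ℝ) : ℂ) * jacobiG d k l u
        = tripleCount X (u, u, 1) • ((X.card : ℂ)⁻¹ * jacobiG d k l u) := fun u => by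
      simp only [tripleDistribution, nsmul_eq_mul]
      push_cast
      ring
    simp only [h1]
    rw [h]
    have hpos := sum_jacobiG_nonneg (E := EuclideanSpace ℂ (Fin d)) (d := d) (by omega) (by simp)
      k l X fun b hb => inner_self_of_subset_unitSphere hX hb
    have hc : (0 : ℂ) ≤ ((((X.card : ℝ)⁻¹ : ℝ)) : ℂ) := by exact_mod_cast (by positivity)
    convert mul_nonneg hc hpos using 1
    -- Spread over a, the constant term supplies the diagonal b = a of the double sum.
    have h2 : jacobiG d k l 1 = ∑ a ∈ X, (X.card : ℂ)⁻¹ * jacobiG d k l 1 := by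
      rw [Finset.sum_const, nsmul_eq_mul]
      field_simp
    rw [h2, ← Finset.sum_add_distrib, Finset.mul_sum]
    refine Finset.sum_congr rfl fun a ha => ?_
    rw [← Finset.add_sum_erase X _ ha, ← Finset.add_sum_erase X _ ha,
      inner_self_of_subset_unitSphere hX ha, if_pos rfl, zero_add, mul_add, Finset.mul_sum]
    push_cast
    congr 1
    refine Finset.sum_congr rfl fun b hb => ?_
    rw [if_neg (Finset.ne_of_mem_erase hb).symm]
  zonal k l i j hi hj := by
    have h0 : (X.card : ℂ) ≠ 0 := by exact_mod_cast hne.card_ne_zero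
    have h := add_finsum_tripleCount_smul hA hX hXA fun p =>
      (X.card : ℂ)⁻¹ • zonalY d k l i j p.1 p.2.1 p.2.2
    have h1 : ∀ p, ((tripleDistribution X p : ℝ) : ℂ) • zonalY d k l i j p.1 p.2.1 p.2.2
        = tripleCount X p • (X.card : ℂ)⁻¹ • zonalY d k l i j p.1 p.2.1 p.2.2 := fun p => by
      rw [← Nat.cast_smul_eq_nsmul ℂ, smul_smul, tripleDistribution, div_eq_mul_inv]
      push_cast
      rfl
    rw [← Nat.cast_smul_eq_nsmul ℂ, smul_smul, mul_inv_cancel₀ h0, one_smul] at h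
    simp only [h1]
    rw [h]
    have hc : (0 : ℂ) ≤ (X.card : ℂ)⁻¹ := by
      simp
    refine Matrix.posSemidef_sum _ fun a ha => ?_
    simp only [tripleType, ← Finset.smul_sum]
    exact (posSemidef_sum_zonalY hd (by simp) k l i j (inner_self_of_subset_unitSphere hX ha) X
      fun b hb => inner_self_of_subset_unitSphere hX hb).smul hc

theorem card_le_one_add_sdpOptimum (hd : 3 ≤ d) (hA : A ⊆ Metric.closedBall (0 : ℂ) 1 \ {1})
    (hX : (X : Set (EuclideanSpace ℂ (Fin d))) ⊆ unitSphere d)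
    (hXA : innerProductSet (X : Set (EuclideanSpace ℂ (Fin d))) ⊆ A) (hne : X.Nonempty) :
    ((X.card : ℝ) : EReal) ≤ 1 + sdpOptimum d A := by
  have h : (((X.card : ℝ) - 1 : ℝ) : EReal) ≤ sdpOptimum d A := by
    rw [← finsum_tripleDistribution_pair hA hX hXA hne]
    exact le_iSup₂_of_le (tripleDistribution X) (sdpFeasible_tripleDistribution hd hA hX hXA hne)
      le_rfl
  refine le_trans (le_of_eq ?_) (add_le_add_right h 1)
  rw [← EReal.coe_one, ← EReal.coe_add]
  congr 1
  ring

end Code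

theorem mainTheorem1 (d : ℕ) (hd : 3 ≤ d) (A : Set ℂ)
    (hA : A ⊆ Metric.closedBall (0 : ℂ) 1 \ {1})
    (hconj : {z : ℂ | ∃ c ∈ A, z = conj c} = A)
    (X : Finset (EuclideanSpace ℂ (Fin d)))
    (hX : (X : Set (EuclideanSpace ℂ (Fin d))) ⊆ unitSphere d)
    (hXA : innerProductSet (X : Set (EuclideanSpace ℂ (Fin d))) ⊆ A) :
    ((X.card : ℝ) : EReal) ≤ 1 + sdpOptimum d A := by
  -- The distribution divides by the size of `X`. For empty `X`, a one-point code, with no distinct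
  -- pairs to constrain, gives 1 ≤ 1 + sup, which suffices.
  rcases X.eq_empty_or_nonempty with rfl | hne
  · let e : EuclideanSpace ℂ (Fin d) := EuclideanSpace.single ⟨0, by omega⟩ 1
    have h := card_le_one_add_sdpOptimum (X := {e}) hd hA
      (by simp [unitSphere, e])
      (by
        rintro c ⟨a, ha, b, hb, hab, -⟩
        simp only [Finset.coe_singleton, Set.mem_singleton_iff] at ha hb
        exact (hab (ha.trans hb.symm)).elim)
      (Finset.singleton_nonempty e)
    refine le_trans ?_ h
    simp
  · exact card_le_one_add_sdpOptimum hd hA hX hXA hne
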